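/- Let $\mathbb{F}$ be an algebraically closed field of characteristic $p > 3$ (so $p$ is a prime), and let $\mathfrak{sl}_3(\mathbb{F})$ be the Lie algebra of traceless $3\times 3$ matrices over $\mathbb{F}$. For a subalgebra $H$ of a Lie algebra $\mathfrak{L}$ over $\mathbb{F}$ and a linear functional $\alpha$ on $H$ put $\mathfrak{L}_\alpha=\{x\in\mathfrak{L} : [x,h]=\alpha(h)x \text{ for all } h\in H\}$, and call $\alpha$ a root if $\mathfrak{L}_\alpha\neq 0$. A classical Cartan subalgebra of $\mathfrak{L}$ is an abelian, self-normalizing subalgebra $H$ such that (a) $\mathfrak{L}=\bigoplus_\alpha \mathfrak{L}_\alpha$; (b) $[\mathfrak{L}_\alpha,\mathfrak{L}_{-\alpha}]$ is one-dimensional for every root $\alpha\neq 0$; (c) for all roots $\alpha,\beta$ with $\beta\ne 0$, not all of $\alpha+k\beta$, $1\le k\le p-1$, are roots. A classical orthogonal decomposition (COD) of $\mathfrak{L}$ is a decomposition of $\mathfrak{L}$, as a vector space, into a direct sum of classical Cartan subalgebras which are pairwise orthogonal with respect to the Killing form $K(A,B)=\mathrm{Tr}(\mathrm{ad}A\cdot\mathrm{ad}B)$.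 Two CODs are conjugate if some automorphism of the Lie algebra $\mathfrak{L}$ maps the components of the first one bijectively to the components of the second one. Then $\mathfrak{sl}_3(\mathbb{F})$ has a COD $\mathfrak{sl}_3(\mathbb{F})=H_0\oplus H_1\oplus H_2\oplus H_3$ with four components, and any two CODs of $\mathfrak{sl}_3(\mathbb{F})$ are conjugate. -/

import Mathlib

noncomputable section

namespace COD

section RootSpaces

variable {F L : Type*} [Field F] [LieRing L] [LieAlgebra F L]

/-- The space `L_α` of all `x` in `L` with `[x, h] = α(h) x` for every `h` in `H`. -/
def rootSpace (H : LieSubalgebra F L) (α : Module.Dual F H) : Submodule F L where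
  carrier := {x | ∀ h : H, ⁅x, (h : L)⁆ = α h • x}
  zero_mem' := fun h => by simp
  add_mem' := fun {x y} hx hy h => by rw [add_lie, hx h, hy h, smul_add]
  smul_mem' := fun c x hx h => by rw [smul_lie, hx h, smul_comm]

/-- A root of `L` relative to `H`: a functional whose root space is nonzero. The functional `0`
is allowed. -/
def IsRoot (H : LieSubalgebra F L) (α : Module.Dual F H) : Prop :=
  rootSpace H α ≠ ⊥

/-- The linear span `[U, V]` of all brackets `[x, y]` with `x` in `U` and `y` in `V`. -/
def bracketSpan (U V : Submodule F L) : Submodule F L :=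
  Submodule.span F {z | ∃ x ∈ U, ∃ y ∈ V, ⁅x, y⁆ = z}

/-- Classical Cartan subalgebras of a Lie algebra over a field of characteristic `p > 3`
(`p = ringChar F`). -/
structure IsClassicalCartan (H : LieSubalgebra F L) : Prop where
  isCartan : H.IsCartanSubalgebra
  isAbelian : IsLieAbelian H
  /-- `L` is the direct sum of the root spaces relative to `H`: they are independent
  (functionals that are not roots contribute the zero subspace) ... -/
  rootSpace_indep : iSupIndep (rootSpace H)
  /-- ... and they span `L`. -/
  rootSpace_span : ⨆ α, rootSpace H α = ⊤
  bracket_one_dim : ∀ α : Module.Dual F H, IsRoot H α → α ≠ 0 →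
    Module.finrank F (bracketSpan (rootSpace H α) (rootSpace H (-α))) = 1
  root_string : ∀ α β : Module.Dual F H, IsRoot H α → IsRoot H β → β ≠ 0 →
    ∃ k : ℕ, 1 ≤ k ∧ k ≤ ringChar F - 1 ∧ ¬ IsRoot H (α + k • β)

/-- A classical orthogonal decomposition of `L`, given by its set of components: `L` is, as a
vector space, the direct sum of classical Cartan subalgebras that are pairwise orthogonal with
respect to the Killing form. -/
structure IsCOD (S : Set (LieSubalgebra F L)) : Prop where
  classical : ∀ H ∈ S, IsClassicalCartan H
  orthogonal : ∀ H ∈ S, ∀ H' ∈ S, H ≠ H' → ∀ x ∈ H, ∀ y ∈ H', killingForm F L x y = 0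
  indep : iSupIndep (fun H : S => (H : LieSubalgebra F L).toSubmodule)
  span : ⨆ H : S, (H : LieSubalgebra F L).toSubmodule = ⊤

/-- Two decompositions are conjugate if some automorphism of the Lie algebra `L` maps the components
of the first one bijectively to the components of the second one. -/
def Conjugate (S T : Set (LieSubalgebra F L)) : Prop :=
  ∃ φ : L ≃ₗ⁅F⁆ L, Set.BijOn (fun H => H.map φ.toLieHom) S T

end RootSpaces

end COD

end

namespace COD

open Matrix

attribute [local instance 100] LieRing.ofAssociativeRing

variable {F : Type*} [Field F]

/-! An abelian `H` has a joint eigenvector `v` in `F^3`. Root vectors send `v` to joint eigenvectors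
or `0`, and since `sl_3` is the sum of the root spaces and `sl_3 v + F v = F^3`, joint eigenvectors
span. A classical Cartan subalgebra therefore consists of matrices diagonal in a common basis, and
being self-normalizing it is all of `cart g` (`IsClassicalCartan.exists_eq_cart`). The Killing form
is `6 Tr(AB)`, and `6` is invertible, so only trace orthogonality matters.

Conjugate one component to the diagonal algebra. If `cart g` is orthogonal to it, then `g i k * g⁻¹
k i = 1/3` for all `i`, `k`. This forces the ratio of any column of `g` to the first one to be a
geometric progression whose ratio is a cube root of unity, so `cart g` contains a monomial matrix
`cyc x y z` with `xyz = 1` (`exists_cyc_mem`). The centralizer of this element is spanned by it, its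
square and the identity, so it determines `cart g`.

A diagonal conjugation moves the monomial element of a second component to `cyc 1 1 1`. For any
other component, orthogonality leaves only `cyc 1 μ μ²` with `μ` a root of `X² + X + 1`. Thus every
COD is conjugate to a subset of four standard components; nondegeneracy of the trace form on each of
them excludes omissions. The standard family itself is a COD, by direct computation. -/

/-- The Lie algebra of traceless `3 × 3` matrices. -/
abbrev Sl3 (F : Type*) [Field F] := LieAlgebra.SpecialLinear.sl (Fin 3) F

theorem trace_coe (x : Sl3 F) : trace (x : Matrix (Fin 3) (Fin 3) F) = 0 :=
  LinearMap.mem_ker.1 x.2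

/-- A traceless matrix as an element of `Sl3 F`. -/
def ofTraceless (A : Matrix (Fin 3) (Fin 3) F) (h : trace A = 0) : Sl3 F :=
  ⟨A, LinearMap.mem_ker.2 h⟩

@[simp]
theorem coe_ofTraceless (A : Matrix (Fin 3) (Fin 3) F) (h : trace A = 0) :
    (ofTraceless A h : Matrix (Fin 3) (Fin 3) F) = A := rfl

theorem coe_bracket (x y : Sl3 F) :
    (⁅x, y⁆ : Sl3 F).val = x.val * y.val - y.val * x.val := rfl

theorem bracket_eq_zero_iff (x y : Sl3 F) :
    ⁅x, y⁆ = 0 ↔ x.val * y.val = y.val * x.val := by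
  rw [← sub_eq_zero (a := x.val * y.val), ← coe_bracket]
  exact Subtype.ext_iff

/-- Conjugation by an invertible matrix, as an automorphism of `Sl3 F`. -/
def conj (g : GL (Fin 3) F) : Sl3 F ≃ₗ⁅F⁆ Sl3 F where
  toFun x := ofTraceless (g.val * x.val * g⁻¹.val) (by
    rw [trace_mul_comm, ← mul_assoc, Units.inv_mul, one_mul, trace_coe])
  invFun x := ofTraceless (g⁻¹.val * x.val * g.val) (by
    rw [trace_mul_comm, ← mul_assoc, Units.mul_inv, one_mul, trace_coe])
  map_add' x y := Subtype.ext <| by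
    simp [mul_add, add_mul]
  map_smul' c x := Subtype.ext <| by simp
  map_lie' {x y} := Subtype.ext <| by
    simp only [coe_bracket, coe_ofTraceless, mul_sub, sub_mul]
    congr 1 <;> simp only [mul_assoc, Units.inv_mul_cancel_left]
  left_inv x := Subtype.ext <| by
    simp [mul_assoc]
  right_inv x := Subtype.ext <| by
    simp [mul_assoc]

theorem coe_conj (g : GL (Fin 3) F) (x : Sl3 F) :
    (conj g x).val = g.val * x.val * g⁻¹.val := rfl

theorem isDiag_mul {A B : Matrix (Fin 3) (Fin 3) F} (hA : A.IsDiag) (hB : B.IsDiag) :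
    (A * B).IsDiag := by
  rw [← hA.diagonal_diag, ← hB.diagonal_diag, diagonal_mul_diagonal]
  exact isDiag_diagonal _

theorem isDiag_mul_comm {A B : Matrix (Fin 3) (Fin 3) F} (hA : A.IsDiag) (hB : B.IsDiag) :
    A * B = B * A := by
  rw [← hA.diagonal_diag, ← hB.diagonal_diag, diagonal_mul_diagonal, diagonal_mul_diagonal]
  simp_rw [mul_comm]

/-- The traceless matrices that are diagonal in the basis given by the columns of `g`. -/
def cart (g : GL (Fin 3) F) : LieSubalgebra F (Sl3 F) where
  carrier := {x | (g⁻¹.val * x.val * g.val).IsDiag}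
  zero_mem' := by simp
  add_mem' {x y} hx hy := by
    simpa [mul_add, add_mul] using IsDiag.add hx hy
  smul_mem' c x hx := by
    simpa using IsDiag.smul c hx
  lie_mem' {x y} hx hy := by
    have h := (isDiag_mul hx hy).sub (isDiag_mul hy hx)
    simpa only [coe_bracket, Set.mem_ofPred_eq, mul_sub, sub_mul, mul_assoc,
      Units.mul_inv_cancel_left] using h

theorem mem_cart {g : GL (Fin 3) F} {x : Sl3 F} :
    x ∈ cart g ↔ (g⁻¹.val * x.val * g.val).IsDiag := Iff.rfl

theorem mem_cart_one {x : Sl3 F} : x ∈ cart (1 : GL (Fin 3) F) ↔ x.val.IsDiag := by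
  simp [mem_cart]

theorem map_conj_cart (h g : GL (Fin 3) F) :
    (cart g).map (conj h).toLieHom = cart (h * g) := by
  ext x
  rw [LieSubalgebra.mem_map]
  constructor
  · rintro ⟨y, hy, rfl⟩
    rw [mem_cart] at hy ⊢
    convert hy using 1
    change (h * g)⁻¹.val * (h.val * y.val * h⁻¹.val) * (h * g).val = _
    simp [mul_assoc, - coe_units_inv]
  · intro hx
    refine ⟨(conj h).symm x, ?_, (conj h).apply_symm_apply x⟩
    rw [mem_cart] at hx ⊢
    convert hx using 1
    change _ * (h⁻¹.val * x.val * h.val) * _ = _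
    simp [mul_assoc, - coe_units_inv]

theorem conj_mem_cart (g : GL (Fin 3) F) {x : Sl3 F} (hx : x ∈ cart 1) : conj g x ∈ cart g := by
  have h := map_conj_cart g 1
  rw [mul_one] at h
  rw [← h]
  exact (LieSubalgebra.mem_map _ _ _).2 ⟨x, hx, rfl⟩

theorem cart_mul_isDiag (g t : GL (Fin 3) F) (ht : t.val.IsDiag) (ht' : t⁻¹.val.IsDiag) :
    cart (g * t) = cart g := by
  ext x
  rw [mem_cart, mem_cart]
  constructor
  · intro h
    convert isDiag_mul (isDiag_mul ht h) ht' using 1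
    simp [mul_assoc, - coe_units_inv]
  · intro h
    convert isDiag_mul (isDiag_mul ht' h) ht using 1
    simp [mul_assoc, - coe_units_inv]

theorem commute_of_mem_cart {g : GL (Fin 3) F} {x y : Sl3 F} (hx : x ∈ cart g) (hy : y ∈ cart g) :
    x.val * y.val = y.val * x.val := by
  have h := isDiag_mul_comm hx hy
  have h2 : g.val * ((g⁻¹.val * x.val * g.val) * (g⁻¹.val * y.val * g.val)) * g⁻¹.val =
    g.val * ((g⁻¹.val * y.val * g.val) * (g⁻¹.val * x.val * g.val)) * g⁻¹.val := by rw [h]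
  simpa [mul_assoc, - coe_units_inv] using h2

/-! ### The Killing form -/

/-- The map `ad x ∘ ad y` extends to all `3 × 3` matrices with image in the traceless ones, so the
extension has the same trace, which can be summed over matrix units. The factor `6` is `2n` for `n =
3`. -/
theorem killingForm_eq (x y : Sl3 F) :
    killingForm F (Sl3 F) x y = 6 * trace (x.val * y.val) := by
  let f : Matrix (Fin 3) (Fin 3) F →ₗ[F] Matrix (Fin 3) (Fin 3) F :=
    (LinearMap.mulLeft F x.val - LinearMap.mulRight F x.val) ∘ₗ
      (LinearMap.mulLeft F y.val - LinearMap.mulRight F y.val)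
  have hf : ∀ A, f A ∈ (Sl3 F).toSubmodule := fun A => by
    change trace (f A) = 0
    simp only [f, LinearMap.comp_apply, LinearMap.sub_apply, LinearMap.mulLeft_apply,
      LinearMap.mulRight_apply]
    rw [trace_sub, trace_mul_comm, sub_self]
  have h := LinearMap.trace_restrict_eq_of_forall_mem _ f hf
  rw [killingForm_apply_apply]
  refine Eq.trans ?_ (h.trans ?_)
  · rfl
  · rw [LinearMap.trace_eq_matrix_trace F (Matrix.stdBasis F (Fin 3) (Fin 3)), trace,
      Fintype.sum_prod_type]
    have key : ∀ i j : Fin 3, diag (LinearMap.toMatrix (stdBasis F (Fin 3) (Fin 3))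
        (stdBasis F (Fin 3) (Fin 3)) f) (i, j) =
        (x.val * y.val) i i - x.val i i * y.val j j - y.val i i * x.val j j
          + (y.val * x.val) j j := by
      intro i j
      rw [diag_apply, LinearMap.toMatrix_apply, stdBasis_eq_single]
      have : ∀ A : Matrix (Fin 3) (Fin 3) F, (stdBasis F (Fin 3) (Fin 3)).repr A (i, j) = A i j := by
        intro A
        rfl
      rw [this]
      simp only [f, LinearMap.comp_apply, LinearMap.sub_apply, LinearMap.mulLeft_apply,
        LinearMap.mulRight_apply, mul_sub, sub_mul, Matrix.sub_apply]
      rw [← mul_assoc, mul_assoc (single i j 1), ← mul_assoc x.val, mul_single_apply_same,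
        single_mul_apply_same]
      simp only [mul_apply, single_apply, mul_ite, mul_one, mul_zero, one_mul]
      fin_cases i <;> fin_cases j <;> simp [Fin.sum_univ_three] <;> ring
    have hx := trace_coe x
    have hy := trace_coe y
    simp only [key]
    simp only [trace, diag_apply, Fin.sum_univ_three, mul_apply] at hx hy ⊢
    linear_combination (-2 * (y.val 0 0 + y.val 1 1 + y.val 2 2)) * hx

/-! ### Simultaneous diagonalization of classical Cartan subalgebras -/

/-- A self-normalizing subalgebra is maximal among commutative subalgebras. -/
theorem IsClassicalCartan.eq_of_le {L : Type*} [LieRing L] [LieAlgebra F L]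
    {H K : LieSubalgebra F L} (hH : IsClassicalCartan H)
    (hle : H ≤ K) (hK : ∀ x ∈ K, ∀ y ∈ K, ⁅x, y⁆ = 0) : H = K := by
  refine le_antisymm hle fun x hx => ?_
  rw [← hH.isCartan.self_normalizing, LieSubalgebra.mem_normalizer_iff]
  intro y hy
  rw [hK x hx y (hle hy)]
  exact H.zero_mem

/-- The vectors that are eigenvectors of all elements of `H`. -/
def jointEigenvectors (H : LieSubalgebra F (Sl3 F)) : Set (Fin 3 → F) :=
  {w | ∃ χ : H → F, ∀ h : H, h.val.val *ᵥ w = χ h • w}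

/-- Applying `x h - h x = α(h) x` to a vector of weight `χ` shows that `x` shifts the weight to `χ -
α`. -/
theorem mulVec_mem_jointEigenvectors {H : LieSubalgebra F (Sl3 F)} {v : Fin 3 → F}
    (hv : v ∈ jointEigenvectors H) {α : Module.Dual F H} {x : Sl3 F} (hx : x ∈ rootSpace H α) :
    x.val *ᵥ v ∈ jointEigenvectors H := by
  obtain ⟨χ, hχ⟩ := hv
  refine ⟨fun h => χ h - α h, fun h => ?_⟩
  have h1 : x.val * h.val.val - h.val.val * x.val = α h • x.val := congrArg Subtype.val (hx h)
  have h2 := congrArg (fun A => A *ᵥ v) h1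
  simp only [sub_mulVec, ← mulVec_mulVec, hχ h, mulVec_smul, smul_mulVec] at h2
  rw [sub_smul, ← h2]
  abel

/-- A rank-one matrix sends `v` to `w`; removing its scalar part, which needs `3 ≠ 0`, makes it
traceless. -/
theorem exists_traceless_mulVec_eq (h3 : (3 : F) ≠ 0) {v : Fin 3 → F} (hv : v ≠ 0)
    (w : Fin 3 → F) : ∃ (x : Sl3 F) (c : F), w = x.val *ᵥ v + c • v := by
  obtain ⟨k, hk⟩ := Function.ne_iff.1 hv
  let A : Matrix (Fin 3) (Fin 3) F := vecMulVec w (Pi.single k (v k)⁻¹)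
  refine ⟨ofTraceless (A - (trace A / 3) • (1 : Matrix (Fin 3) (Fin 3) F)) ?_, trace A / 3, ?_⟩
  · rw [trace_sub, trace_smul, trace_one]
    simp [h3]
  · have : A *ᵥ v = w := by
      rw [vecMulVec_mulVec, single_dotProduct, inv_mul_cancel₀ hk]
      simp
    simp [sub_mulVec, smul_mulVec, this]

theorem span_jointEigenvectors [IsAlgClosed F] (h3 : (3 : F) ≠ 0) {H : LieSubalgebra F (Sl3 F)}
    (hH : IsClassicalCartan H) : Submodule.span F (jointEigenvectors H) = ⊤ := by
  have := hH.isAbelian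
  obtain ⟨χ, hχ⟩ :=
    LieModule.exists_nontrivial_weightSpace_of_isNilpotent (k := F) (L := H) (M := Fin 3 → F)
  obtain ⟨⟨v, hv⟩, hv0⟩ := exists_ne (0 : LieModule.weightSpace (Fin 3 → F) χ)
  replace hv0 : v ≠ 0 := fun h => hv0 (Subtype.ext h)
  rw [LieModule.mem_weightSpace] at hv
  have hvE : v ∈ jointEigenvectors H := ⟨χ, hv⟩
  let ev : Sl3 F →ₗ[F] (Fin 3 → F) :=
    { toFun x := x.val *ᵥ v
      map_add' x y := add_mulVec _ _ _
      map_smul' c x := smul_mulVec _ _ _ }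
  have hev : ∀ x : Sl3 F, x.val *ᵥ v ∈ Submodule.span F (jointEigenvectors H) := by
    have : ⊤ ≤ (Submodule.span F (jointEigenvectors H)).comap ev := by
      rw [← hH.rootSpace_span]
      exact iSup_le fun α x hx => Submodule.subset_span (mulVec_mem_jointEigenvectors hvE hx)
    exact fun x => this (Submodule.mem_top (x := x))
  refine eq_top_iff.2 fun w _ => ?_
  obtain ⟨x, c, rfl⟩ := exists_traceless_mulVec_eq h3 hv0 w
  exact add_mem (hev x) (Submodule.smul_mem _ _ (Submodule.subset_span hvE))

/-- Every classical Cartan subalgebra of `Sl3 F` is diagonal in a suitable basis. -/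
theorem IsClassicalCartan.exists_eq_cart [IsAlgClosed F] (h3 : (3 : F) ≠ 0)
    {H : LieSubalgebra F (Sl3 F)} (hH : IsClassicalCartan H) :
    ∃ g : GL (Fin 3) F, H = cart g := by
  have hspan := (span_jointEigenvectors h3 hH).ge
  let b' := Module.Basis.ofSpan hspan
  have : Finite _ := Module.Finite.finite_basis b'
  have : Fintype _ := Fintype.ofFinite ((linearIndepOn_empty F id).extend
    (Set.empty_subset (jointEigenvectors H)))
  have hcard : Fintype.card ((linearIndepOn_empty F id).extend
    (Set.empty_subset (jointEigenvectors H))) = 3 := by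
    rw [← Module.finrank_eq_card_basis b', Module.finrank_fin_fun]
  let b := b'.reindex (Fintype.equivFinOfCardEq hcard)
  have hb : ∀ i, b i ∈ jointEigenvectors H := fun i => by
    refine Module.Basis.ofSpan_subset hspan ?_
    simp only [b, b', Module.Basis.reindex_apply]
    exact Set.mem_range_self _
  let e := Pi.basisFun F (Fin 3)
  let g : GL (Fin 3) F :=
    ⟨e.toMatrix b, b.toMatrix e, e.toMatrix_mul_toMatrix_flip b, b.toMatrix_mul_toMatrix_flip e⟩
  -- The columns of `g` are joint eigenvectors, so `H ≤ cart g`; equality follows because `cart g`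
  -- is commutative and `H` is self-normalizing.
  refine ⟨g, hH.eq_of_le (fun x hx => ?_) fun x hx y hy =>
    (bracket_eq_zero_iff x y).2 (commute_of_mem_cart hx hy)⟩
  have hb' : ∀ i, ∃ c : F, x.val *ᵥ b i = c • b i := fun i => by
    obtain ⟨χ, hχ⟩ := hb i
    exact ⟨_, hχ ⟨x, hx⟩⟩
  choose c hc using hb'
  have : x.val * g.val = g.val * diagonal c := by
    ext i j
    rw [mul_diagonal]
    have := congrFun (hc j) i
    simp only [Pi.smul_apply, smul_eq_mul] at this
    change (∑ k, x.val i k * b j k) = b j i * c j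
    rw [mul_comm, ← this]
    rfl
  rw [mem_cart, mul_assoc, this, ← mul_assoc, Units.inv_mul, one_mul]
  exact isDiag_diagonal _

/-! ### Roots of the diagonal subalgebra -/

/-- The functional `h ↦ h_jj - h_ii` on the diagonal subalgebra. -/
def diagRoot (i j : Fin 3) : Module.Dual F (cart (1 : GL (Fin 3) F)) where
  toFun h := h.val.val j j - h.val.val i i
  map_add' x y := by simp; ring
  map_smul' c x := by simp; ring

theorem diagRoot_apply (i j : Fin 3) (h : cart (1 : GL (Fin 3) F)) :
    diagRoot i j h = h.val.val j j - h.val.val i i := rfl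

theorem diagRoot_self (i : Fin 3) : (diagRoot i i : Module.Dual F (cart 1)) = 0 := by
  ext h
  simp [diagRoot_apply]

theorem neg_diagRoot (i j : Fin 3) : -(diagRoot i j : Module.Dual F (cart 1)) = diagRoot j i := by
  ext h
  simp [diagRoot_apply]

/-- The diagonal element `E_ii - 1/3`. -/
def diagElement (h3 : (3 : F) ≠ 0) (i : Fin 3) : cart (1 : GL (Fin 3) F) :=
  ⟨ofTraceless (diagonal fun k => (if k = i then 1 else 0) - 1 / 3) (by
    rw [trace_diagonal, Finset.sum_sub_distrib]
    simp [h3]), mem_cart_one.2 (isDiag_diagonal _)⟩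

theorem diagRoot_diagElement (h3 : (3 : F) ≠ 0) (i k l : Fin 3) :
    diagRoot k l (diagElement h3 i) = (if l = i then 1 else 0) - (if k = i then 1 else 0) := by
  simp [diagRoot_apply, diagElement]

/-- Evaluation at `E_ii - 1/3` and `E_jj - 1/3` recovers the indices; `2 ≠ 0` separates the values
`1` and `-1`. -/
theorem diagRoot_injective (h2 : (2 : F) ≠ 0) (h3 : (3 : F) ≠ 0) {i j k l : Fin 3} (hij : i ≠ j)
    (h : (diagRoot i j : Module.Dual F (cart 1)) = diagRoot k l) : i = k ∧ j = l := by
  have h2' : (1 : F) + 1 ≠ 0 := by rwa [one_add_one_eq_two]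
  have hi := diagRoot_diagElement h3 i i j
  have hj := diagRoot_diagElement h3 j i j
  rw [h, diagRoot_diagElement] at hi hj
  constructor
  · by_contra hk
    rw [if_neg (Ne.symm hk), if_neg hij.symm, if_pos (rfl : i = i)] at hi
    split_ifs at hi
    · exact h2' (by linear_combination hi)
    · simp at hi
  · by_contra hl
    rw [if_neg (Ne.symm hl), if_neg hij, if_pos (rfl : j = j)] at hj
    split_ifs at hj
    · exact h2' (by linear_combination -hj)
    · simp at hj

/-- For diagonal `h` the `(i, j)` entry of `[x, h]` is `x_ij (h_jj - h_ii)`, so the condition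
decouples entry by entry. -/
theorem mem_rootSpace_diag {α : Module.Dual F (cart (1 : GL (Fin 3) F))} {x : Sl3 F} :
    x ∈ rootSpace (cart 1) α ↔ ∀ i j, x.val i j = 0 ∨ α = diagRoot i j := by
  have key : ∀ h : cart (1 : GL (Fin 3) F), ⁅x, (h : Sl3 F)⁆ = α h • x ↔
      ∀ i j, x.val i j = 0 ∨ α h = diagRoot i j h := by
    intro h
    have hd := (mem_cart_one.1 h.2).diagonal_diag
    rw [Subtype.ext_iff, coe_bracket, ← hd, ← Matrix.ext_iff]
    refine forall₂_congr fun i j => ?_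
    simp only [Matrix.sub_apply, mul_diagonal, diagonal_mul, diag_apply, diagRoot_apply]
    change _ = α h * x.val i j ↔ _
    rw [← sub_eq_zero, show x.val i j * h.val.val j j - h.val.val i i * x.val i j -
      α h * x.val i j = x.val i j * ((h.val.val j j - h.val.val i i) - α h) by ring, mul_eq_zero,
      sub_eq_zero (a := _ - _), eq_comm (b := α h)]
  change (∀ h : cart (1 : GL (Fin 3) F), _) ↔ _
  simp only [key]
  constructor
  · intro h i j
    by_cases hx : x.val i j = 0
    · exact Or.inl hx
    · exact Or.inr (LinearMap.ext fun k => (h k i j).resolve_left hx)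
  · exact fun h k i j => (h i j).imp_right fun e => by rw [e]

theorem exists_eq_diagRoot {α : Module.Dual F (cart (1 : GL (Fin 3) F))}
    (h : IsRoot (cart 1) α) : ∃ i j, α = diagRoot i j := by
  obtain ⟨x, hx, hx0⟩ := Submodule.exists_mem_ne_zero_of_ne_bot h
  by_contra! hc
  refine hx0 (Subtype.ext (Matrix.ext fun i j => ?_))
  exact (mem_rootSpace_diag.1 hx i j).resolve_right (hc i j)

theorem single_mem_rootSpace {i j : Fin 3} (hij : i ≠ j) (c : F) :
    LieAlgebra.SpecialLinear.single i j hij c ∈ rootSpace (cart 1) (diagRoot i j) := by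
  refine mem_rootSpace_diag.2 fun k l => ?_
  rw [LieAlgebra.SpecialLinear.val_single, single_apply]
  split_ifs with h
  · exact Or.inr (by rw [h.1, h.2])
  · exact Or.inl rfl

theorem eq_single_of_mem_rootSpace (h2 : (2 : F) ≠ 0) (h3 : (3 : F) ≠ 0) {i j : Fin 3}
    (hij : i ≠ j) {x : Sl3 F} (hx : x ∈ rootSpace (cart 1) (diagRoot i j)) :
    x = LieAlgebra.SpecialLinear.single i j hij (x.val i j) := by
  refine Subtype.ext (Matrix.ext fun k l => ?_)
  rw [LieAlgebra.SpecialLinear.val_single, single_apply]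
  split_ifs with h
  · rw [h.1, h.2]
  · exact (mem_rootSpace_diag.1 hx k l).resolve_right fun e => h (diagRoot_injective h2 h3 hij e)

theorem exists_diag_add_singles (x : Sl3 F) : ∃ d ∈ cart (1 : GL (Fin 3) F),
    x = d + ∑ i : Fin 3, ∑ j : Fin 3, if h : i ≠ j then
      LieAlgebra.SpecialLinear.single i j h (x.val i j) else 0 := by
  refine ⟨ofTraceless (diagonal (diag x.val)) ?_, mem_cart_one.2 (isDiag_diagonal _), ?_⟩
  · rw [trace_diagonal]
    exact trace_coe x
  · refine Subtype.ext (Matrix.ext fun k l => ?_)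
    fin_cases k <;> fin_cases l <;> simp [Fin.sum_univ_three]

theorem iSup_rootSpace_diag :
    ⨆ α : Module.Dual F (cart (1 : GL (Fin 3) F)), rootSpace (cart 1) α = ⊤ := by
  refine eq_top_iff.2 fun x _ => ?_
  obtain ⟨d, hd, hx⟩ := exists_diag_add_singles x
  rw [hx]
  refine add_mem (Submodule.mem_iSup_of_mem 0 (mem_rootSpace_diag.2 fun i j => ?_))
    (sum_mem fun i _ => sum_mem fun j _ => ?_)
  · rcases eq_or_ne i j with rfl | hij
    · exact Or.inr (diagRoot_self i).symm
    · exact Or.inl (mem_cart_one.1 hd hij)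
  · split_ifs with h
    · exact Submodule.mem_iSup_of_mem _ (single_mem_rootSpace h _)
    · exact zero_mem _

theorem iSupIndep_rootSpace_diag : iSupIndep (rootSpace (cart (1 : GL (Fin 3) F))) := by
  intro α
  rw [Submodule.disjoint_def]
  intro x hx hx'
  -- The root spaces other than that of `α` vanish at every position whose root is `α`, whereas that
  -- of `α` vanishes at all other positions.
  let P : Submodule F (Sl3 F) :=
    { carrier := {y | ∀ i j, α = diagRoot i j → y.val i j = 0}
      zero_mem' := fun i j _ => rfl
      add_mem' := fun {y z} hy hz i j h => by simp [hy i j h, hz i j h]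
      smul_mem' := fun c y hy i j h => by simp [hy i j h] }
  have hP : ⨆ β, ⨆ (_ : β ≠ α), rootSpace (cart 1) β ≤ P :=
    iSup₂_le fun β hβ y hy i j hα =>
      (mem_rootSpace_diag.1 hy i j).resolve_right fun h => hβ (h.trans hα.symm)
  refine Subtype.ext (Matrix.ext fun i j => ?_)
  exact (mem_rootSpace_diag.1 hx i j).elim id fun h => hP hx' i j h

theorem finrank_bracketSpan_diag (h2 : (2 : F) ≠ 0) (h3 : (3 : F) ≠ 0) {i j : Fin 3}
    (hij : i ≠ j) : Module.finrank F (bracketSpan (rootSpace (cart (1 : GL (Fin 3) F))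
      (diagRoot i j)) (rootSpace (cart 1) (-diagRoot i j))) = 1 := by
  let z : Sl3 F := ⁅LieAlgebra.SpecialLinear.single i j hij (1 : F),
    LieAlgebra.SpecialLinear.single j i hij.symm 1⁆
  have hz : z ≠ 0 := fun h => by
    have h' := congrFun (congrFun ((coe_bracket _ _).symm.trans (congrArg Subtype.val h)) i) i
    simp [single_mul_single_same, hij.symm] at h'
  have : bracketSpan (rootSpace (cart (1 : GL (Fin 3) F))
      (diagRoot i j)) (rootSpace (cart 1) (-diagRoot i j)) = Submodule.span F {z} := by
    refine le_antisymm (Submodule.span_le.2 ?_) (Submodule.span_le.2 ?_)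
    · rintro _ ⟨x, hx, y, hy, rfl⟩
      rw [neg_diagRoot] at hy
      rw [eq_single_of_mem_rootSpace h2 h3 hij hx, eq_single_of_mem_rootSpace h2 h3 hij.symm hy,
        ← mul_one (x.val i j), ← mul_one (y.val j i), ← smul_eq_mul, ← smul_eq_mul, map_smul,
        map_smul, smul_lie, lie_smul]
      exact Submodule.smul_mem _ _ (Submodule.smul_mem _ _ (Submodule.mem_span_singleton_self z))
    · rw [Set.singleton_subset_iff]
      exact Submodule.subset_span ⟨_, single_mem_rootSpace hij 1, _,
        by rw [neg_diagRoot]; exact single_mem_rootSpace hij.symm 1, rfl⟩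
  rw [this, finrank_span_singleton hz]

/-- At `E_ii - 1/3` every root takes a value in `{0, 1, -1}` and `β` takes `-1`. Choosing `k` so
that `α + kβ` takes the value `-2` leaves this set, since `2`, `3` and `1` are nonzero. The three
values of `α` give `k = 2, 3, 1`, all at most `p - 1`. -/
theorem exists_not_isRoot_diag (hF : 3 < ringChar F) (h2 : (2 : F) ≠ 0) (h3 : (3 : F) ≠ 0)
    {α β : Module.Dual F (cart (1 : GL (Fin 3) F))} (hα : IsRoot (cart 1) α)
    (hβ : IsRoot (cart 1) β) (hβ0 : β ≠ 0) :
    ∃ k : ℕ, 1 ≤ k ∧ k ≤ ringChar F - 1 ∧ ¬ IsRoot (cart 1) (α + k • β) := by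
  obtain ⟨i, j, rfl⟩ := exists_eq_diagRoot hβ
  have hij : i ≠ j := fun h => hβ0 (by rw [h, diagRoot_self])
  have hval : ∀ {γ : Module.Dual F (cart (1 : GL (Fin 3) F))}, IsRoot (cart 1) γ →
      γ (diagElement h3 i) = 0 ∨ γ (diagElement h3 i) = 1 ∨ γ (diagElement h3 i) = -1 := by
    intro γ hγ
    obtain ⟨k, l, rfl⟩ := exists_eq_diagRoot hγ
    rw [diagRoot_diagElement]
    split_ifs <;> simp
  have hβi : diagRoot i j (diagElement h3 i) = (-1 : F) := by
    simp [diagRoot_diagElement, hij.symm]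
  have hnot : ∀ k : ℕ, α (diagElement h3 i) = k - 2 → ¬ IsRoot (cart 1) (α + k • diagRoot i j) := by
    intro k hk hr
    have h := hval hr
    rw [LinearMap.add_apply, LinearMap.smul_apply, hβi, hk, nsmul_eq_mul] at h
    rcases h with h | h | h
    · exact h2 (by linear_combination -h)
    · exact h3 (by linear_combination -h)
    · exact one_ne_zero (α := F) (by linear_combination -h)
  rcases hval hα with h | h | h
  · exact ⟨2, by norm_num, by omega, hnot 2 (by rw [h]; norm_num)⟩
  · exact ⟨3, by norm_num, by omega, hnot 3 (by rw [h]; norm_num)⟩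
  · exact ⟨1, by norm_num, by omega, hnot 1 (by rw [h]; norm_num)⟩

theorem isLieAbelian_cart (g : GL (Fin 3) F) : IsLieAbelian (cart g) :=
  ⟨fun x y => Subtype.ext ((bracket_eq_zero_iff x.val y.val).2 (commute_of_mem_cart x.2 y.2))⟩

theorem isCartanSubalgebra_cart_one (h3 : (3 : F) ≠ 0) :
    (cart (1 : GL (Fin 3) F)).IsCartanSubalgebra := by
  have := isLieAbelian_cart (1 : GL (Fin 3) F)
  refine ⟨inferInstance, le_antisymm (fun x hx => ?_) (LieSubalgebra.le_normalizer _)⟩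
  rw [LieSubalgebra.mem_normalizer_iff] at hx
  rw [mem_cart_one]
  intro i j hij
  -- The `(i, j)` entry of the bracket of `x` with `E_ii - 1/3` is `-x_ij`.
  have h := mem_cart_one.1 (hx _ (diagElement h3 i).2) hij
  rw [coe_bracket] at h
  simp only [diagElement, coe_ofTraceless, Matrix.sub_apply, mul_diagonal, diagonal_mul,
    if_pos, if_neg hij.symm] at h
  linear_combination -h

theorem isClassicalCartan_cart_one (hF : 3 < ringChar F) (h2 : (2 : F) ≠ 0) (h3 : (3 : F) ≠ 0) :
    IsClassicalCartan (cart (1 : GL (Fin 3) F)) where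
  isCartan := isCartanSubalgebra_cart_one h3
  isAbelian := isLieAbelian_cart 1
  rootSpace_indep := iSupIndep_rootSpace_diag
  rootSpace_span := iSup_rootSpace_diag
  bracket_one_dim α hα hα0 := by
    obtain ⟨i, j, rfl⟩ := exists_eq_diagRoot hα
    exact finrank_bracketSpan_diag h2 h3 fun h => hα0 (by rw [h, diagRoot_self])
  root_string _ _ hα hβ hβ0 := exists_not_isRoot_diag hF h2 h3 hα hβ hβ0

/-! ### Transport of classical Cartan subalgebras along automorphisms -/

section Transport

variable {L : Type*} [LieRing L] [LieAlgebra F L]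

/-- Pulling back functionals along the restriction of `φ` to `H`. -/
def pullback (φ : L ≃ₗ⁅F⁆ L) (H : LieSubalgebra F L) :
    Module.Dual F (H.map φ.toLieHom) ≃ₗ[F] Module.Dual F H :=
  (φ.lieSubalgebraMap H).toLinearEquiv.dualMap

theorem rootSpace_map (φ : L ≃ₗ⁅F⁆ L) (H : LieSubalgebra F L)
    (α : Module.Dual F (H.map φ.toLieHom)) :
    rootSpace (H.map φ.toLieHom) α =
      (rootSpace H (pullback φ H α)).map (φ.toLinearEquiv : L →ₗ[F] L) := by
  ext x
  rw [Submodule.mem_map]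
  constructor
  · intro hx
    refine ⟨φ.symm x, fun h => φ.injective ?_, φ.apply_symm_apply x⟩
    have := hx (φ.lieSubalgebraMap H h)
    change ⁅x, φ h⁆ = _ at this
    change φ _ = _
    rw [LieEquiv.map_lie, φ.apply_symm_apply, this]
    change _ = φ.toLinearEquiv (_ • φ.symm x)
    rw [map_smul]
    change _ = _ • φ (φ.symm x)
    rw [φ.apply_symm_apply]
    rfl
  · rintro ⟨y, hy, rfl⟩ h
    obtain ⟨h, rfl⟩ := (φ.lieSubalgebraMap H).surjective h
    change ⁅φ y, φ h⁆ = _ • φ.toLinearEquiv y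
    rw [← LieEquiv.map_lie, hy h, ← map_smul]
    rfl

theorem isRoot_map_iff (φ : L ≃ₗ⁅F⁆ L) (H : LieSubalgebra F L)
    (α : Module.Dual F (H.map φ.toLieHom)) :
    IsRoot (H.map φ.toLieHom) α ↔ IsRoot H (pullback φ H α) := by
  rw [IsRoot, IsRoot, rootSpace_map, ne_eq, ne_eq,
    Submodule.map_eq_bot_iff]

theorem bracketSpan_map (φ : L ≃ₗ⁅F⁆ L) (U V : Submodule F L) :
    bracketSpan (U.map (φ.toLinearEquiv : L →ₗ[F] L)) (V.map (φ.toLinearEquiv : L →ₗ[F] L)) =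
      (bracketSpan U V).map (φ.toLinearEquiv : L →ₗ[F] L) := by
  rw [bracketSpan, bracketSpan, Submodule.map_span]
  congr 1
  ext z
  constructor
  · rintro ⟨_, ⟨x, hx, rfl⟩, _, ⟨y, hy, rfl⟩, rfl⟩
    exact ⟨⁅x, y⁆, ⟨x, hx, y, hy, rfl⟩, φ.toLieHom.map_lie x y⟩
  · rintro ⟨_, ⟨x, hx, y, hy, rfl⟩, rfl⟩
    exact ⟨_, ⟨x, hx, rfl⟩, _, ⟨y, hy, rfl⟩, (φ.toLieHom.map_lie x y).symm⟩

theorem isLieAbelian_map (φ : L ≃ₗ⁅F⁆ L) {H : LieSubalgebra F L} (hH : IsLieAbelian H) :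
    IsLieAbelian (H.map φ.toLieHom) := by
  constructor
  intro x y
  obtain ⟨x, rfl⟩ := (φ.lieSubalgebraMap H).surjective x
  obtain ⟨y, rfl⟩ := (φ.lieSubalgebraMap H).surjective y
  rw [← LieHom.map_lie, hH.trivial x y, map_zero]

theorem normalizer_map (φ : L ≃ₗ⁅F⁆ L) {H : LieSubalgebra F L} (hH : H.normalizer = H) :
    (H.map φ.toLieHom).normalizer = H.map φ.toLieHom := by
  refine le_antisymm (fun x hx => ?_) (LieSubalgebra.le_normalizer _)
  rw [LieSubalgebra.mem_normalizer_iff] at hx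
  refine (LieSubalgebra.mem_map _ _ _).2 ⟨φ.symm x, ?_, φ.apply_symm_apply x⟩
  rw [← hH, LieSubalgebra.mem_normalizer_iff]
  intro y hy
  obtain ⟨z, hz, h⟩ := (LieSubalgebra.mem_map _ _ _).1
    (hx (φ y) ((LieSubalgebra.mem_map _ _ _).2 ⟨y, hy, rfl⟩))
  have : ⁅φ.symm x, y⁆ = z := φ.injective (by
    change φ _ = _
    rw [LieEquiv.map_lie, φ.apply_symm_apply]
    exact h.symm)
  rwa [this]

theorem IsClassicalCartan.map (φ : L ≃ₗ⁅F⁆ L) {H : LieSubalgebra F L} (hH : IsClassicalCartan H) :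
    IsClassicalCartan (H.map φ.toLieHom) := by
  have habel := isLieAbelian_map φ hH.isAbelian
  have hrs : rootSpace (H.map φ.toLieHom) =
      fun α => (rootSpace H (pullback φ H α)).map (φ.toLinearEquiv : L →ₗ[F] L) :=
    funext (rootSpace_map φ H)
  refine ⟨⟨inferInstance, normalizer_map φ hH.isCartan.self_normalizing⟩, habel, ?_, ?_, ?_, ?_⟩
  · rw [hrs]
    exact (hH.rootSpace_indep.comp (pullback φ H).injective).map_orderIso
      (Submodule.orderIsoMapComap φ.toLinearEquiv)
  · rw [hrs, ← Submodule.map_iSup, (pullback φ H).surjective.iSup_comp (rootSpace H),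
      hH.rootSpace_span, Submodule.map_top, LinearEquiv.range]
  · intro α hα hα0
    rw [rootSpace_map, rootSpace_map, bracketSpan_map, LinearEquiv.finrank_map_eq, map_neg]
    exact hH.bracket_one_dim _ ((isRoot_map_iff φ H α).1 hα)
      fun h => hα0 ((pullback φ H).map_eq_zero_iff.1 h)
  · intro α β hα hβ hβ0
    obtain ⟨k, h1, h2, h3⟩ := hH.root_string _ _ ((isRoot_map_iff φ H α).1 hα)
      ((isRoot_map_iff φ H β).1 hβ) fun h => hβ0 ((pullback φ H).map_eq_zero_iff.1 h)
    refine ⟨k, h1, h2, fun h => h3 ?_⟩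
    rwa [isRoot_map_iff, map_add, map_nsmul] at h

end Transport

/-! ### Monomial elements and their centralizers -/

/-- The monomial matrix of the cyclic permutation with nonzero entries `x`, `y`, `z`. -/
def cyc (x y z : F) : Sl3 F :=
  ofTraceless !![0, x, 0; 0, 0, y; z, 0, 0] (by simp [trace, Fin.sum_univ_three])

/-- The monomial matrix of the inverse cyclic permutation with nonzero entries `x`, `y`, `z`. -/
def cycInv (x y z : F) : Sl3 F :=
  ofTraceless !![0, 0, x; y, 0, 0; 0, z, 0] (by simp [trace, Fin.sum_univ_three])

theorem coe_cyc (x y z : F) : (cyc x y z).val = !![0, x, 0; 0, 0, y; z, 0, 0] := rfl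

theorem coe_cycInv (x y z : F) : (cycInv x y z).val = !![0, 0, x; y, 0, 0; 0, z, 0] := rfl

theorem coe_cycInv_eq_sq (x y z : F) :
    (cycInv (x * y) (y * z) (z * x)).val = (cyc x y z).val * (cyc x y z).val := by
  rw [coe_cyc, coe_cycInv]
  ext i j
  fin_cases i <;> fin_cases j <;> simp [mul_apply, Fin.sum_univ_three]

theorem cycInv_mem_cart {g : GL (Fin 3) F} {x y z : F} (h : cyc x y z ∈ cart g) :
    cycInv (x * y) (y * z) (z * x) ∈ cart g := by
  rw [mem_cart] at h ⊢
  rw [coe_cycInv_eq_sq]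
  convert isDiag_mul h h using 1
  simp [mul_assoc, - coe_units_inv]

theorem cyc_mem_cart_of_mul_eq {g : GL (Fin 3) F} {x y z : F} (d : Fin 3 → F)
    (h : (cyc x y z).val * g.val = g.val * diagonal d) : cyc x y z ∈ cart g := by
  rw [mem_cart, mul_assoc, h, ← mul_assoc, Units.inv_mul, one_mul]
  exact isDiag_diagonal _

/-- The centralizer of `cyc x y z` is spanned by `cyc x y z` and its square. -/
theorem exists_eq_of_commute_cyc (h3 : (3 : F) ≠ 0) {x y z : F} (hx : x ≠ 0) (hy : y ≠ 0)
    {A : Sl3 F} (h : A.val * (cyc x y z).val = (cyc x y z).val * A.val) :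
    ∃ c d : F, A = c • cyc x y z + d • cycInv (x * y) (y * z) (z * x) := by
  have ht := trace_coe A
  rw [coe_cyc] at h
  have e : ∀ i j, (A.val * !![0, x, 0; 0, 0, y; z, 0, 0]) i j =
    (!![0, x, 0; 0, 0, y; z, 0, 0] * A.val) i j := fun i j => by rw [h]
  have e00 := e 0 0
  have e01 := e 0 1
  have e02 := e 0 2
  have e10 := e 1 0
  have e11 := e 1 1
  have e12 := e 1 2
  have e22 := e 2 2
  simp [mul_apply, Fin.sum_univ_three] at e00 e01 e02 e10 e11 e12 e22
  simp only [trace, diag_apply, Fin.sum_univ_three] at ht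
  have d01 : A.val 0 0 = A.val 1 1 := mul_right_cancel₀ hx (by linear_combination e01)
  have d12 : A.val 1 1 = A.val 2 2 := mul_right_cancel₀ hy (by linear_combination e12)
  -- The centralizer among all matrices also contains the scalars; trace zero and `3 ≠ 0` remove
  -- them.
  have d0 : A.val 0 0 = 0 :=
    (mul_eq_zero.1 (show 3 * A.val 0 0 = 0 by linear_combination ht + 2 * d01 + d12)).resolve_left h3
  refine ⟨A.val 0 1 / x, A.val 0 2 / (x * y), Subtype.ext (Matrix.ext fun i j => ?_)⟩
  change A.val i j = A.val 0 1 / x * (cyc x y z).val i j +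
    A.val 0 2 / (x * y) * (cycInv (x * y) (y * z) (z * x)).val i j
  rw [coe_cyc, coe_cycInv]
  fin_cases i <;> fin_cases j <;> simp <;> (try field_simp)
  · exact d0
  · linear_combination -e00
  · exact d01 ▸ d0
  · linear_combination -e02
  · refine mul_right_cancel₀ hy ?_
    linear_combination -x * e10 - z * e02
  · linear_combination e22
  · exact d12 ▸ d01 ▸ d0

/-- `cart g` is commutative, so it lies in the centralizer of `cyc x y z`; conversely it contains
this element and its square. -/
theorem mem_cart_iff_of_cyc_mem (h3 : (3 : F) ≠ 0) {g : GL (Fin 3) F} {x y z : F}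
    (hxyz : x * y * z = 1) (h : cyc x y z ∈ cart g) (A : Sl3 F) :
    A ∈ cart g ↔ ∃ c d : F, A = c • cyc x y z + d • cycInv (x * y) (y * z) (z * x) := by
  have h0 : x * y * z ≠ 0 := hxyz ▸ one_ne_zero
  constructor
  · intro hA
    exact exists_eq_of_commute_cyc h3 (left_ne_zero_of_mul (left_ne_zero_of_mul h0))
      (right_ne_zero_of_mul (left_ne_zero_of_mul h0)) (commute_of_mem_cart hA h)
  · rintro ⟨c, d, rfl⟩
    exact add_mem ((cart g).smul_mem c h) ((cart g).smul_mem d (cycInv_mem_cart h))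

theorem cart_eq_of_cyc_mem (h3 : (3 : F) ≠ 0) {g g' : GL (Fin 3) F} {x y z : F}
    (hxyz : x * y * z = 1) (h : cyc x y z ∈ cart g) (h' : cyc x y z ∈ cart g') :
    cart g = cart g' := by
  ext A
  rw [mem_cart_iff_of_cyc_mem h3 hxyz h, mem_cart_iff_of_cyc_mem h3 hxyz h']

/-! ### Trace orthogonality -/

/-- Orthogonality with respect to the trace form. -/
def TraceOrtho (H K : LieSubalgebra F (Sl3 F)) : Prop :=
  ∀ x ∈ H, ∀ y ∈ K, trace (x.val * y.val) = 0

theorem TraceOrtho.symm {H K : LieSubalgebra F (Sl3 F)} (h : TraceOrtho H K) : TraceOrtho K H :=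
  fun x hx y hy => by rw [trace_mul_comm, h y hy x hx]

theorem TraceOrtho.map_conj {H K : LieSubalgebra F (Sl3 F)} (h : TraceOrtho H K)
    (g : GL (Fin 3) F) :
    TraceOrtho (H.map (conj g).toLieHom) (K.map (conj g).toLieHom) := by
  intro x hx y hy
  obtain ⟨x, hx', rfl⟩ := (LieSubalgebra.mem_map _ _ _).1 hx
  obtain ⟨y, hy', rfl⟩ := (LieSubalgebra.mem_map _ _ _).1 hy
  change trace ((g.val * x.val * g⁻¹.val) * (g.val * y.val * g⁻¹.val)) = 0
  rw [mul_assoc, ← mul_assoc g⁻¹.val, ← mul_assoc g⁻¹.val, Units.inv_mul, one_mul,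
    ← mul_assoc, trace_mul_comm, ← mul_assoc, ← mul_assoc, Units.inv_mul, one_mul, h x hx' y hy']

theorem trace_mul_diagElement (h3 : (3 : F) ≠ 0) (x : Sl3 F) (i : Fin 3) :
    trace (x.val * (diagElement h3 i).val.val) = x.val i i := by
  have hx := trace_coe x
  simp only [trace, diag_apply] at hx
  change trace (x.val * diagonal _) = _
  simp [trace, mul_diagonal, mul_sub, ← Finset.sum_mul, hx]

/-- The trace form is nondegenerate on `cart g`. -/
theorem eq_zero_of_mem_cart (h3 : (3 : F) ≠ 0) {g : GL (Fin 3) F} {x : Sl3 F} (hx : x ∈ cart g)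
    (h : ∀ y ∈ cart g, trace (x.val * y.val) = 0) : x = 0 := by
  have hd := mem_cart.1 hx
  have hii : ∀ i, (g⁻¹.val * x.val * g.val) i i = 0 := fun i => by
    rw [← coe_ofTraceless (g⁻¹.val * x.val * g.val) (by
      rw [trace_mul_comm, ← mul_assoc, Units.mul_inv, one_mul, trace_coe]),
      ← trace_mul_diagElement h3, coe_ofTraceless]
    have hm := conj_mem_cart g (diagElement h3 i).2
    have := h _ hm
    rw [coe_conj, ← mul_assoc, trace_mul_comm] at this
    rw [← this]
    simp only [mul_assoc]
  have h0 : g⁻¹.val * x.val * g.val = 0 := by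
    ext i j
    rcases eq_or_ne i j with rfl | hij
    · exact hii i
    · exact hd hij
  refine Subtype.ext ?_
  have : x.val = g.val * (g⁻¹.val * x.val * g.val) * g⁻¹.val := by
    simp [mul_assoc, - coe_units_inv]
  rw [this, h0]
  simp

/-- Pairing `g (E_kk - 1/3) g⁻¹` with `E_ii - 1/3` gives `g_ik g⁻¹_ki - 1/3`, which orthogonality
makes zero. -/
theorem mul_inv_eq_third (h3 : (3 : F) ≠ 0) {g : GL (Fin 3) F}
    (h : TraceOrtho (cart g) (cart 1)) (i k : Fin 3) :
    g.val i k * g⁻¹.val k i = 1 / 3 := by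
  have hm := conj_mem_cart g (diagElement h3 k).2
  have := h _ hm _ (diagElement h3 i).2
  rw [trace_mul_diagElement, coe_conj] at this
  have hone : ∑ j, g.val i j * g⁻¹.val j i = 1 := by
    rw [← mul_apply, Units.mul_inv, one_apply_eq]
  change (g.val * (diagonal _ : Matrix (Fin 3) (Fin 3) F) * g⁻¹.val) i i = 0 at this
  rw [mul_apply] at this
  simp only [mul_diagonal, mul_sub, sub_mul, Finset.sum_sub_distrib] at this
  simp only [mul_ite, mul_one, mul_zero, ite_mul, zero_mul, Finset.sum_ite_eq', Finset.mem_univ,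
    if_true] at this
  have hs : ∑ j, g.val i j * (1 / 3) * g⁻¹.val j i = 1 / 3 := by
    calc ∑ j, g.val i j * (1 / 3) * g⁻¹.val j i = ∑ j, 1 / 3 * (g.val i j * g⁻¹.val j i) :=
          Finset.sum_congr rfl fun j _ => by ring
      _ = 1 / 3 := by rw [← Finset.mul_sum, hone, mul_one]
  exact (sub_eq_zero.1 this).trans hs

/-! ### Subalgebras orthogonal to the diagonal one -/

/-- A triple whose first two elementary symmetric functions vanish is a geometric progression whose
ratio is a primitive third root of unity. -/
theorem exists_ratio {a b c : F} (ha : a ≠ 0) (h1 : a + b + c = 0)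
    (h2 : a * b + b * c + c * a = 0) : ∃ μ : F, μ ^ 2 + μ + 1 = 0 ∧ b = μ * a ∧ c = μ ^ 2 * a := by
  have hb : (b / a) * a = b := div_mul_cancel₀ b ha
  have hμ : (b / a) ^ 2 + b / a + 1 = 0 := by
    refine (mul_eq_zero.1 (?_ : ((b / a) ^ 2 + b / a + 1) * a ^ 2 = 0)).resolve_right
      (pow_ne_zero 2 ha)
    have : ((b / a) ^ 2 + b / a + 1) * a ^ 2 = b ^ 2 + b * a + a ^ 2 := by
      field_simp
    rw [this]
    linear_combination (a + b) * h1 - h2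
  refine ⟨b / a, hμ, hb.symm, ?_⟩
  linear_combination h1 - a * hμ + hb

/-- The entries of `g⁻¹` are `1 / (3 g_ik)`, transposed. For `k ≠ 0` the entries `(0, k)` and `(k,
0)` of `g⁻¹ g = 1` say that the ratios `g_ik / g_i0` and their inverses both sum to zero, so
`exists_ratio` applies. -/
theorem exists_column_ratio (h3 : (3 : F) ≠ 0) {g : GL (Fin 3) F}
    (h : TraceOrtho (cart g) (cart 1)) (k : Fin 3) : ∃ μ : F,
    μ ^ 3 = 1 ∧ g.val 1 k / g.val 1 0 = μ * (g.val 0 k / g.val 0 0) ∧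
      g.val 2 k / g.val 2 0 = μ ^ 2 * (g.val 0 k / g.val 0 0) := by
  have hp := mul_inv_eq_third h3 h
  have hne : ∀ i j, g.val i j ≠ 0 := fun i j h0 => by
    have := hp i j
    rw [h0, zero_mul] at this
    exact one_div_ne_zero h3 this.symm
  have hi : ∀ i j, g⁻¹.val j i = 1 / (3 * g.val i j) := fun i j => by
    rw [eq_div_iff (mul_ne_zero h3 (hne i j)), mul_comm 3, ← mul_assoc, mul_comm _ (g.val i j),
      hp, div_mul_cancel₀ _ h3]
  rcases eq_or_ne k 0 with rfl | hk
  · exact ⟨1, by simp, by rw [div_self (hne _ _), div_self (hne _ _), one_mul],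
      by rw [div_self (hne _ _), div_self (hne _ _), one_pow, one_mul]⟩
  have e1 : (g⁻¹.val * g.val) 0 k = 0 := by rw [Units.inv_mul, one_apply_ne hk.symm]
  have e2 : (g⁻¹.val * g.val) k 0 = 0 := by rw [Units.inv_mul, one_apply_ne hk]
  rw [mul_apply, Fin.sum_univ_three, hi, hi, hi] at e1 e2
  have n0 := hne 0 0
  have n1 := hne 1 0
  have n2 := hne 2 0
  have m0 := hne 0 k
  have m1 := hne 1 k
  have m2 := hne 2 k
  obtain ⟨μ, hμ, hb, hc⟩ := exists_ratio (a := g.val 0 k / g.val 0 0)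
    (b := g.val 1 k / g.val 1 0) (c := g.val 2 k / g.val 2 0) (div_ne_zero m0 n0)
    (by field_simp at e1 ⊢; linear_combination e1) (by field_simp at e2 ⊢; linear_combination e2)
  exact ⟨μ, by linear_combination (μ - 1) * hμ, hb, hc⟩

/-- A Cartan subalgebra orthogonal to the diagonal one contains a monomial element. -/
theorem exists_cyc_mem (h3 : (3 : F) ≠ 0) {g : GL (Fin 3) F}
    (h : TraceOrtho (cart g) (cart 1)) : ∃ x y z : F, x * y * z = 1 ∧ cyc x y z ∈ cart g := by
  have hp := mul_inv_eq_third h3 h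
  have hne : ∀ i j, g.val i j ≠ 0 := fun i j h0 => by
    have := hp i j
    rw [h0, zero_mul] at this
    exact one_div_ne_zero h3 this.symm
  choose μ hμ h1 h2 using exists_column_ratio h3 h
  have n0 := hne 0 0
  have n1 := hne 1 0
  have n2 := hne 2 0
  -- These entries are forced by requiring column `0` of `g` to be fixed; column `k` is then an
  -- eigenvector with eigenvalue `μ k`.
  refine ⟨g.val 0 0 / g.val 1 0, g.val 1 0 / g.val 2 0, g.val 2 0 / g.val 0 0, by field_simp,
    cyc_mem_cart_of_mul_eq μ ?_⟩
  ext i k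
  have h1k : g.val 1 k = μ k * (g.val 0 k / g.val 0 0) * g.val 1 0 := by
    rw [← h1, div_mul_cancel₀ _ n1]
  have h2k : g.val 2 k = μ k ^ 2 * (g.val 0 k / g.val 0 0) * g.val 2 0 := by
    rw [← h2, div_mul_cancel₀ _ n2]
  rw [mul_diagonal, coe_cyc, mul_apply, Fin.sum_univ_three]
  fin_cases i
  · simp
    rw [h1k]
    field_simp
  · simp
    rw [h1k, h2k]
    field_simp
  · simp
    rw [h2k]
    field_simp
    linear_combination -(g.val 0 k) * hμ k

/-- The monomial matrix `cyc x y z` with `x y z = 1` lies in some `cart g`. -/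
theorem exists_cart_cyc_mem (h3 : (3 : F) ≠ 0) {ω : F} (hω : ω ^ 2 + ω + 1 = 0) {x y z : F}
    (hxyz : x * y * z = 1) : ∃ g : GL (Fin 3) F, cyc x y z ∈ cart g := by
  have h0 : x * y * z ≠ 0 := hxyz ▸ one_ne_zero
  have hx := left_ne_zero_of_mul (left_ne_zero_of_mul h0)
  have hy := right_ne_zero_of_mul (left_ne_zero_of_mul h0)
  -- The columns are eigenvectors of `cyc x y z` for `1`, `ω`, `ω²`. Up to row scaling by `xy`, `y`,
  -- `1` this is the Fourier matrix of order three, whose determinant has square `-27`.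
  let A : Matrix (Fin 3) (Fin 3) F := !![x * y, x * y, x * y; y, y * ω, y * ω ^ 2;
    1, ω ^ 2, ω]
  have hA : A.det ≠ 0 := fun hd => by
    have : A.det ^ 2 = -3 ^ 3 * (x * y ^ 2) ^ 2 := by
      simp only [A, det_fin_three, of_apply, cons_val', cons_val_zero, cons_val_one, cons_val,
        cons_val_fin_one]
      linear_combination (27 - 27 * ω + 4 * ω ^ 2 + 11 * ω ^ 3 - 6 * ω ^ 4 - ω ^ 5 + ω ^ 6) *
        (x * y ^ 2) ^ 2 * hω
    rw [hd] at this
    refine mul_ne_zero (neg_ne_zero.2 (pow_ne_zero 3 h3))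
      (pow_ne_zero 2 (mul_ne_zero hx (pow_ne_zero 2 hy))) (this.symm.trans (by norm_num))
  have hω3 : ω ^ 3 = 1 := by linear_combination (ω - 1) * hω
  refine ⟨GeneralLinearGroup.mkOfDetNeZero A hA, cyc_mem_cart_of_mul_eq ![1, ω, ω ^ 2] ?_⟩
  change _ * A = A * _
  ext i j
  rw [mul_diagonal, coe_cyc, mul_apply, Fin.sum_univ_three]
  have hz : z * (x * y) = 1 := by rw [mul_comm, hxyz]
  fin_cases i <;> fin_cases j <;> simp [A]
  · ring
  · ring
  · ring
  · linear_combination -y * ω * hω3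
  · exact hz
  · linear_combination hz - hω3
  · linear_combination hz - hω3

/-! ### Orthogonality between monomial subalgebras -/

theorem trace_cyc_mul_cycInv (x y z a b c : F) :
    trace ((cyc x y z).val * (cycInv a b c).val) = x * b + y * c + z * a := by
  rw [coe_cyc, coe_cycInv]
  simp [trace, Fin.sum_univ_three]

theorem trace_cyc_mul_cyc (x y z a b c : F) :
    trace ((cyc x y z).val * (cyc a b c).val) = 0 := by
  rw [coe_cyc, coe_cyc]
  simp [trace, Fin.sum_univ_three]

theorem trace_cycInv_mul_cycInv (x y z a b c : F) :
    trace ((cycInv x y z).val * (cycInv a b c).val) = 0 := by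
  rw [coe_cycInv, coe_cycInv]
  simp [trace, Fin.sum_univ_three]

theorem traceOrtho_cart_one_of_cyc_mem (h3 : (3 : F) ≠ 0) {g : GL (Fin 3) F} {x y z : F}
    (hxyz : x * y * z = 1) (h : cyc x y z ∈ cart g) : TraceOrtho (cart 1) (cart g) := by
  intro A hA B hB
  obtain ⟨c, d, rfl⟩ := (mem_cart_iff_of_cyc_mem h3 hxyz h B).1 hB
  rw [← (mem_cart_one.1 hA).diagonal_diag]
  change trace (_ * (c • (cyc x y z).val + d • (cycInv (x * y) (y * z) (z * x)).val)) = 0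
  rw [coe_cyc, coe_cycInv]
  simp [trace, diagonal_mul, Fin.sum_univ_three]

/-- Only products of a `cyc` with a `cycInv` can have nonzero trace; `h1` and `h2` are the two such
traces. -/
theorem traceOrtho_of_cyc_mem (h3 : (3 : F) ≠ 0) {g g' : GL (Fin 3) F} {x y z a b c : F}
    (hxyz : x * y * z = 1) (h : cyc x y z ∈ cart g) (habc : a * b * c = 1)
    (h' : cyc a b c ∈ cart g') (h1 : x * (b * c) + y * (c * a) + z * (a * b) = 0)
    (h2 : a * (y * z) + b * (z * x) + c * (x * y) = 0) : TraceOrtho (cart g) (cart g') := by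
  intro A hA B hB
  obtain ⟨r, s, rfl⟩ := (mem_cart_iff_of_cyc_mem h3 hxyz h A).1 hA
  obtain ⟨t, u, rfl⟩ := (mem_cart_iff_of_cyc_mem h3 habc h' B).1 hB
  change trace ((r • (cyc x y z).val + s • (cycInv (x * y) (y * z) (z * x)).val) *
    (t • (cyc a b c).val + u • (cycInv (a * b) (b * c) (c * a)).val)) = 0
  simp only [add_mul, mul_add, smul_mul, Matrix.mul_smul, trace_add, trace_smul, trace_cyc_mul_cyc,
    trace_cycInv_mul_cycInv, trace_cyc_mul_cycInv,
    trace_mul_comm (cycInv (x * y) (y * z) (z * x)).val (cyc a b c).val, h1, h2, smul_zero,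
    add_zero]

/-- A Cartan subalgebra orthogonal to the diagonal one and to the one of `cyc 1 1 1`. -/
theorem exists_root_cyc_mem (h3 : (3 : F) ≠ 0) {g g' : GL (Fin 3) F}
    (hg : TraceOrtho (cart g) (cart 1)) (h' : cyc 1 1 1 ∈ cart g')
    (hgg' : TraceOrtho (cart g) (cart g')) :
    ∃ μ : F, μ ^ 2 + μ + 1 = 0 ∧ cyc 1 μ (μ ^ 2) ∈ cart g := by
  obtain ⟨x, y, z, hxyz, h⟩ := exists_cyc_mem h3 hg
  have h0 : x * y * z ≠ 0 := hxyz ▸ one_ne_zero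
  have hx := left_ne_zero_of_mul (left_ne_zero_of_mul h0)
  have e1 := hgg' _ h _ (cycInv_mem_cart h')
  have e2 := hgg' _ (cycInv_mem_cart h) _ h'
  rw [trace_cyc_mul_cycInv] at e1
  rw [trace_mul_comm, trace_cyc_mul_cycInv] at e2
  -- Pairing with `cyc 1 1 1` and its square gives `x + y + z = 0` and `xy + yz + zx = 0`.
  obtain ⟨μ, hμ, hy, hz⟩ := exists_ratio hx (b := y) (c := z) (by linear_combination e1)
    (by linear_combination e2)
  refine ⟨μ, hμ, ?_⟩
  have : cyc 1 μ (μ ^ 2) = x⁻¹ • cyc x y z := by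
    refine Subtype.ext ?_
    change (cyc 1 μ (μ ^ 2)).val = x⁻¹ • (cyc x y z).val
    rw [coe_cyc, coe_cyc, hy, hz]
    ext i j
    fin_cases i <;> fin_cases j <;> simp <;> field_simp
  rw [this]
  exact (cart g).smul_mem _ h

/-! ### Orthogonal spanning families -/

/-- A spanning set of pairwise orthogonal Cartan subalgebras. -/
structure IsOrthoCart (S : Set (LieSubalgebra F (Sl3 F))) : Prop where
  exists_eq_cart : ∀ H ∈ S, ∃ g : GL (Fin 3) F, H = cart g
  ortho : ∀ H ∈ S, ∀ K ∈ S, H ≠ K → TraceOrtho H K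
  span : ∀ P : Submodule F (Sl3 F), (∀ H ∈ S, H.toSubmodule ≤ P) → P = ⊤

theorem IsCOD.isOrthoCart [IsAlgClosed F] (h2 : (2 : F) ≠ 0) (h3 : (3 : F) ≠ 0)
    {S : Set (LieSubalgebra F (Sl3 F))} (hS : IsCOD S) : IsOrthoCart S where
  exists_eq_cart H hH := (hS.classical H hH).exists_eq_cart h3
  ortho H hH K hK hne x hx y hy := by
    have h6 : (6 : F) ≠ 0 := by
      have := mul_ne_zero h2 h3
      norm_num at this
      exact this
    have := hS.orthogonal H hH K hK hne x hx y hy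
    rw [killingForm_eq] at this
    exact (mul_eq_zero.1 this).resolve_left h6
  span P hP := by
    rw [eq_top_iff, ← hS.span]
    exact iSup_le fun H => hP H H.2

theorem IsOrthoCart.image_conj {S : Set (LieSubalgebra F (Sl3 F))} (hS : IsOrthoCart S)
    (g : GL (Fin 3) F) :
    IsOrthoCart ((fun H : LieSubalgebra F (Sl3 F) => H.map (conj g).toLieHom) '' S) where
  exists_eq_cart := by
    rintro _ ⟨H, hH, rfl⟩
    obtain ⟨k, rfl⟩ := hS.exists_eq_cart H hH
    exact ⟨g * k, map_conj_cart g k⟩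
  ortho := by
    rintro _ ⟨H, hH, rfl⟩ _ ⟨K, hK, rfl⟩ hne
    exact (hS.ortho H hH K hK fun h => hne (by rw [h])).map_conj g
  span P hP := by
    have := hS.span (P.comap ((conj g).toLinearEquiv : Sl3 F →ₗ[F] Sl3 F)) fun H hH x hx =>
      hP _ ⟨H, hH, rfl⟩ ((LieSubalgebra.mem_map _ _ _).2 ⟨x, hx, rfl⟩)
    refine eq_top_iff.2 fun x _ => ?_
    have hx : (conj g).symm x ∈ P.comap ((conj g).toLinearEquiv : Sl3 F →ₗ[F] Sl3 F) := by
      rw [this]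
      exact Submodule.mem_top
    have hx' : conj g ((conj g).symm x) ∈ P := hx
    rwa [LieEquiv.apply_symm_apply] at hx'

theorem IsOrthoCart.exists_ne {S : Set (LieSubalgebra F (Sl3 F))} (hS : IsOrthoCart S)
    (K : LieSubalgebra F (Sl3 F)) (hK : K.toSubmodule ≠ ⊤) : ∃ H ∈ S, H ≠ K := by
  by_contra! h
  exact hK (hS.span _ fun H hH => by rw [h H hH])

/-- A component cannot be omitted from an orthogonal decomposition. -/
theorem IsOrthoCart.mem_of_ortho (h3 : (3 : F) ≠ 0) {S : Set (LieSubalgebra F (Sl3 F))}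
    (hS : IsOrthoCart S) {g : GL (Fin 3) F} (h : ∀ H ∈ S, H ≠ cart g → TraceOrtho H (cart g))
    (hne : (cart g).toSubmodule ≠ ⊥) : cart g ∈ S := by
  by_contra hg
  -- If `cart g` were missing, its orthogonal complement would contain every component, hence
  -- everything, including `cart g` itself.
  let P : Submodule F (Sl3 F) :=
    { carrier := {x | ∀ y ∈ cart g, trace (x.val * y.val) = 0}
      zero_mem' := fun y _ => by simp
      add_mem' := fun {a b} ha hb y hy => by simp [add_mul, ha y hy, hb y hy]
      smul_mem' := fun c a ha y hy => by simp [ha y hy] }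
  have hP := hS.span P fun H hH x hx y hy => h H hH (fun e => hg (e ▸ hH)) x hx y hy
  refine hne (eq_bot_iff.2 fun x hx => ?_)
  refine eq_zero_of_mem_cart h3 hx ?_
  have : x ∈ P := hP ▸ Submodule.mem_top
  exact this

/-! ### The standard decomposition -/

/-- The family of components attached to a cube root of unity and bases of eigenvectors. -/
structure IsStandard (ω : F) (f : Fin 4 → GL (Fin 3) F) : Prop where
  root : ω ^ 2 + ω + 1 = 0
  zero : f 0 = 1
  one : cyc 1 1 1 ∈ cart (f 1)
  two : cyc 1 ω (ω ^ 2) ∈ cart (f 2)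
  three : cyc 1 (ω ^ 2) ω ∈ cart (f 3)

theorem exists_isStandard [IsAlgClosed F] (h3 : (3 : F) ≠ 0) :
    ∃ (ω : F) (f : Fin 4 → GL (Fin 3) F), IsStandard ω f := by
  obtain ⟨ω, hω⟩ : ∃ ω : F, ω ^ 2 + ω + 1 = 0 := by
    obtain ⟨ω, h⟩ := IsAlgClosed.exists_root
      (Polynomial.X ^ 2 + Polynomial.X + 1 : Polynomial F) (by
        have : (Polynomial.X ^ 2 + Polynomial.X + 1 : Polynomial F).degree = 2 := by
          compute_degree!
        rw [this]
        norm_num)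
    exact ⟨ω, by simpa [Polynomial.IsRoot] using h⟩
  have hω3 : ω ^ 3 = 1 := by linear_combination (ω - 1) * hω
  obtain ⟨g1, h1⟩ := exists_cart_cyc_mem h3 hω (x := 1) (y := 1) (z := 1) (by ring)
  obtain ⟨g2, h2⟩ := exists_cart_cyc_mem h3 hω (x := 1) (y := ω) (z := ω ^ 2)
    (by linear_combination hω3)
  obtain ⟨g3, h4⟩ := exists_cart_cyc_mem h3 hω (x := 1) (y := ω ^ 2) (z := ω)
    (by linear_combination hω3)
  exact ⟨ω, ![1, g1, g2, g3], hω, rfl, h1, h2, h4⟩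

namespace IsStandard

variable {ω : F} {f : Fin 4 → GL (Fin 3) F}

theorem pow_three (h : IsStandard ω f) : ω ^ 3 = 1 := by
  linear_combination (ω - 1) * h.root

theorem traceOrtho (h3 : (3 : F) ≠ 0) (h : IsStandard ω f) {i j : Fin 4} (hij : i ≠ j) :
    TraceOrtho (cart (f i)) (cart (f j)) := by
  have hω := h.root
  have hω3 := h.pow_three
  have e2 : 1 * ω * ω ^ 2 = 1 := by linear_combination hω3
  have e3 : 1 * ω ^ 2 * ω = 1 := by linear_combination hω3
  have h01 : TraceOrtho (cart (f 0)) (cart (f 1)) :=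
    h.zero ▸ traceOrtho_cart_one_of_cyc_mem h3 (by ring) h.one
  have h02 : TraceOrtho (cart (f 0)) (cart (f 2)) :=
    h.zero ▸ traceOrtho_cart_one_of_cyc_mem h3 e2 h.two
  have h03 : TraceOrtho (cart (f 0)) (cart (f 3)) :=
    h.zero ▸ traceOrtho_cart_one_of_cyc_mem h3 e3 h.three
  have h12 : TraceOrtho (cart (f 1)) (cart (f 2)) :=
    traceOrtho_of_cyc_mem h3 (by ring) h.one e2 h.two (by linear_combination hω + hω3)
      (by linear_combination hω)
  have h13 : TraceOrtho (cart (f 1)) (cart (f 3)) :=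
    traceOrtho_of_cyc_mem h3 (by ring) h.one e3 h.three (by linear_combination hω + hω3)
      (by linear_combination hω)
  have h23 : TraceOrtho (cart (f 2)) (cart (f 3)) :=
    traceOrtho_of_cyc_mem h3 e2 h.two e3 h.three (by linear_combination hω + (1 + ω) * hω3)
      (by linear_combination hω + (1 + ω) * hω3)
  match i, j, hij with
  | 0, 0, h | 1, 1, h | 2, 2, h | 3, 3, h => exact absurd rfl h
  | 0, 1, _ => exact h01
  | 0, 2, _ => exact h02
  | 0, 3, _ => exact h03
  | 1, 2, _ => exact h12
  | 1, 3, _ => exact h13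
  | 2, 3, _ => exact h23
  | 1, 0, _ => exact h01.symm
  | 2, 0, _ => exact h02.symm
  | 3, 0, _ => exact h03.symm
  | 2, 1, _ => exact h12.symm
  | 3, 1, _ => exact h13.symm
  | 3, 2, _ => exact h23.symm

theorem exists_mem_ne_zero (h3 : (3 : F) ≠ 0) (g : GL (Fin 3) F) : ∃ x ∈ cart g, x ≠ 0 := by
  refine ⟨conj g (diagElement h3 0).val, conj_mem_cart g (diagElement h3 0).2, fun h => ?_⟩
  · have h0 := (conj g).injective (h.trans (map_zero (conj g)).symm)
    have := diagRoot_diagElement h3 0 0 1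
    rw [Subtype.ext h0 (a1 := diagElement h3 0) (a2 := 0)] at this
    simp at this

/-- A coincidence would make a nonzero component orthogonal to itself. -/
theorem injective (h3 : (3 : F) ≠ 0) (h : IsStandard ω f) :
    Function.Injective fun i => cart (f i) := by
  intro i j hij
  by_contra hne
  obtain ⟨x, hx, hx0⟩ := exists_mem_ne_zero h3 (f i)
  refine hx0 (eq_zero_of_mem_cart h3 hx fun y hy => h.traceOrtho h3 hne x hx y ?_)
  change cart (f i) = cart (f j) at hij
  rwa [← hij]

theorem iSup_eq_top (h3 : (3 : F) ≠ 0) (h : IsStandard ω f) (P : Submodule F (Sl3 F))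
    (hP : ∀ i, (cart (f i)).toSubmodule ≤ P) : P = ⊤ := by
  have hω := h.root
  have hω3 := h.pow_three
  have m1 := hP 1 h.one
  have m2 := hP 2 h.two
  have m3 := hP 3 h.three
  have n1 := hP 1 (cycInv_mem_cart h.one)
  have n2 := hP 2 (cycInv_mem_cart h.two)
  have n3 := hP 3 (cycInv_mem_cart h.three)
  have hc : ∀ a b c : F, cyc a b c ∈ P := fun a b c => by
    -- The coefficients are the inverse discrete Fourier transform of `(a, b, c)` over `ℤ/3`.
    have : cyc a b c = ((a + b + c) / 3) • cyc 1 1 1 +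
        ((a + ω ^ 2 * b + ω * c) / 3) • cyc 1 ω (ω ^ 2) +
        ((a + ω * b + ω ^ 2 * c) / 3) • cyc 1 (ω ^ 2) ω := by
      refine Subtype.ext ?_
      change (cyc a b c).val = _ • (cyc _ _ _).val + _ • (cyc _ _ _).val + _ • (cyc _ _ _).val
      simp only [coe_cyc]
      ext i j
      fin_cases i <;> fin_cases j <;> simp <;> field_simp
      · linear_combination (-b - c) * hω
      · linear_combination -(a + c) * hω - (2 * b + c * ω) * hω3
      · linear_combination -(a + b) * hω - (2 * c + b * ω) * hω3
    rw [this]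
    exact add_mem (add_mem (P.smul_mem _ m1) (P.smul_mem _ m2)) (P.smul_mem _ m3)
  have hci : ∀ a b c : F, cycInv a b c ∈ P := fun a b c => by
    have : cycInv a b c = ((a + b + c) / 3) • cycInv (1 * 1) (1 * 1) (1 * 1) +
        ((ω ^ 2 * a + b + ω * c) / 3) • cycInv (1 * ω) (ω * ω ^ 2) (ω ^ 2 * 1) +
        ((ω * a + b + ω ^ 2 * c) / 3) • cycInv (1 * ω ^ 2) (ω ^ 2 * ω) (ω * 1) := by
      refine Subtype.ext ?_
      change (cycInv a b c).val =
        _ • (cycInv _ _ _).val + _ • (cycInv _ _ _).val + _ • (cycInv _ _ _).val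
      simp only [coe_cycInv]
      ext i j
      fin_cases i <;> fin_cases j <;> simp <;> field_simp
      · linear_combination -(b + c) * hω - (2 * a + c * ω) * hω3
      · linear_combination -(a + c) * hω - (2 * b + (a + c) * (ω + ω ^ 2)) * hω3
      · linear_combination -(a + b) * hω - (2 * c + a * ω) * hω3
    rw [this]
    exact add_mem (add_mem (P.smul_mem _ n1) (P.smul_mem _ n2)) (P.smul_mem _ n3)
  refine eq_top_iff.2 fun x _ => ?_
  have hd : ofTraceless (diagonal (diag x.val)) (by
      rw [trace_diagonal]
      exact trace_coe x) ∈ P :=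
    hP 0 (by rw [h.zero]; exact mem_cart_one.2 (isDiag_diagonal _))
  have : x = ofTraceless (diagonal (diag x.val)) (by
      rw [trace_diagonal]
      exact trace_coe x) + cyc (x.val 0 1) (x.val 1 2) (x.val 2 0) +
      cycInv (x.val 0 2) (x.val 1 0) (x.val 2 1) := by
    refine Subtype.ext ?_
    change x.val = diagonal (diag x.val) + (cyc _ _ _).val + (cycInv _ _ _).val
    rw [coe_cyc, coe_cycInv]
    ext i j
    fin_cases i <;> fin_cases j <;> simp
  rw [this]
  exact add_mem (add_mem hd (hc _ _ _)) (hci _ _ _)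

theorem isCOD (hF : 3 < ringChar F) (h2 : (2 : F) ≠ 0) (h3 : (3 : F) ≠ 0) (h : IsStandard ω f) :
    IsCOD (Set.range fun i => cart (f i)) where
  classical := by
    rintro _ ⟨i, rfl⟩
    have := (isClassicalCartan_cart_one hF h2 h3).map (conj (f i))
    rwa [map_conj_cart, mul_one] at this
  orthogonal := by
    rintro _ ⟨i, rfl⟩ _ ⟨j, rfl⟩ hne x hx y hy
    rw [killingForm_eq, h.traceOrtho h3 (fun e => hne (by rw [e])) x hx y hy, mul_zero]
  indep := by
    rintro ⟨_, i, rfl⟩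
    rw [Submodule.disjoint_def]
    intro x hx hx'
    refine eq_zero_of_mem_cart h3 hx fun y hy => ?_
    -- The complement of `y` contains all other components, so an element of the intersection is
    -- orthogonal to its own component.
    let P : Submodule F (Sl3 F) :=
      { carrier := {z | trace (z.val * y.val) = 0}
        zero_mem' := by simp
        add_mem' := fun {a b} ha hb => by
          simp only [Set.mem_ofPred_eq] at ha hb
          simp [add_mul, ha, hb]
        smul_mem' := fun c a ha => by
          simp only [Set.mem_ofPred_eq] at ha
          simp [ha] }
    have hle : ⨆ K : Set.range fun i => cart (f i), ⨆ (_ : K ≠ ⟨cart (f i), i, rfl⟩),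
        (K : LieSubalgebra F (Sl3 F)).toSubmodule ≤ P := by
      refine iSup₂_le ?_
      rintro ⟨_, j, rfl⟩ hne z hz
      exact h.traceOrtho h3 (fun e => hne (by rw [e])) z hz y hy
    exact hle hx'
  span := h.iSup_eq_top h3 _ fun i =>
    le_iSup (fun H : Set.range fun i => cart (f i) =>
      (H : LieSubalgebra F (Sl3 F)).toSubmodule) ⟨cart (f i), i, rfl⟩

theorem ncard_range (h3 : (3 : F) ≠ 0) (h : IsStandard ω f) :
    (Set.range fun i => cart (f i)).ncard = 4 := by
  rw [← Set.image_univ, Set.ncard_image_of_injective _ (h.injective h3), Set.ncard_univ,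
    Nat.card_fin]

theorem mem_range_of_ortho (h3 : (3 : F) ≠ 0) (h : IsStandard ω f) {g : GL (Fin 3) F}
    (h0 : TraceOrtho (cart g) (cart (f 0))) (h1 : TraceOrtho (cart g) (cart (f 1))) :
    cart g ∈ Set.range fun i => cart (f i) := by
  rw [h.zero] at h0
  obtain ⟨μ, hμ, hm⟩ := exists_root_cyc_mem h3 h0 h.one h1
  have hω := h.root
  have hμ3 : μ ^ 3 = 1 := by linear_combination (μ - 1) * hμ
  have key : (μ - ω) * (μ - ω ^ 2) = 0 := by
    linear_combination hμ + (ω - 1 - μ) * hω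
  rcases mul_eq_zero.1 key with e | e
  · obtain rfl := sub_eq_zero.1 e
    exact ⟨2, cart_eq_of_cyc_mem h3 (by linear_combination hμ3) h.two hm⟩
  · obtain rfl := sub_eq_zero.1 e
    have : (ω ^ 2) ^ 2 = ω := by linear_combination ω * h.pow_three
    rw [this] at hm
    exact ⟨3, cart_eq_of_cyc_mem h3 (by linear_combination h.pow_three) h.three hm⟩

/-- An orthogonal decomposition containing the first two standard components is standard. -/
theorem eq_range (h3 : (3 : F) ≠ 0) (h : IsStandard ω f) {S : Set (LieSubalgebra F (Sl3 F))}
    (hS : IsOrthoCart S) (h0 : cart (f 0) ∈ S) (h1 : cart (f 1) ∈ S) :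
    S = Set.range fun i => cart (f i) := by
  have hsub : S ⊆ Set.range fun i => cart (f i) := by
    intro H hH
    obtain ⟨g, rfl⟩ := hS.exists_eq_cart H hH
    by_cases e0 : cart g = cart (f 0)
    · exact ⟨0, e0.symm⟩
    by_cases e1 : cart g = cart (f 1)
    · exact ⟨1, e1.symm⟩
    exact h.mem_range_of_ortho h3 (hS.ortho _ hH _ h0 e0) (hS.ortho _ hH _ h1 e1)
  refine hsub.antisymm ?_
  rintro _ ⟨i, rfl⟩
  refine hS.mem_of_ortho h3 (fun H hH hne => ?_) fun hbot => ?_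
  · obtain ⟨j, rfl⟩ := hsub hH
    exact h.traceOrtho h3 fun e => hne (by rw [e])
  · obtain ⟨x, hx, hx0⟩ := exists_mem_ne_zero h3 (f i)
    have : x ∈ (cart (f i)).toSubmodule := hx
    rw [hbot] at this
    exact hx0 this

end IsStandard

/-! ### Conjugacy is transitive and symmetric -/

section Conjugacy

variable {L : Type*} [LieRing L] [LieAlgebra F L]

theorem map_injective_of_equiv (φ : L ≃ₗ⁅F⁆ L) :
    Function.Injective fun H : LieSubalgebra F L => H.map φ.toLieHom := by
  intro H K h
  have h' : ∀ x, φ x ∈ H.map φ.toLieHom ↔ φ x ∈ K.map φ.toLieHom := fun x => by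
    change H.map φ.toLieHom = K.map φ.toLieHom at h
    rw [h]
  have key : ∀ (M : LieSubalgebra F L) x, φ x ∈ M.map φ.toLieHom ↔ x ∈ M := fun M x => by
    rw [LieSubalgebra.mem_map]
    exact ⟨fun ⟨y, hy, e⟩ => φ.injective e ▸ hy, fun hx => ⟨x, hx, rfl⟩⟩
  ext x
  rw [← key H, ← key K, h' x]

theorem map_map_equiv (φ ψ : L ≃ₗ⁅F⁆ L) (H : LieSubalgebra F L) :
    (H.map φ.toLieHom).map ψ.toLieHom = H.map (φ.trans ψ).toLieHom := by
  ext x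
  simp only [LieSubalgebra.mem_map]
  constructor
  · rintro ⟨_, ⟨y, hy, rfl⟩, rfl⟩
    exact ⟨y, hy, rfl⟩
  · rintro ⟨y, hy, rfl⟩
    exact ⟨_, ⟨y, hy, rfl⟩, rfl⟩

theorem conjugate_image (φ : L ≃ₗ⁅F⁆ L) (S : Set (LieSubalgebra F L)) :
    Conjugate S ((fun H => H.map φ.toLieHom) '' S) :=
  ⟨φ, (map_injective_of_equiv φ).injOn.bijOn_image⟩

theorem Conjugate.trans {S T U : Set (LieSubalgebra F L)} (h : Conjugate S T)
    (h' : Conjugate T U) : Conjugate S U := by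
  obtain ⟨φ, hφ⟩ := h
  obtain ⟨ψ, hψ⟩ := h'
  exact ⟨φ.trans ψ, (hψ.comp hφ).congr fun H _ => map_map_equiv φ ψ H⟩

theorem Conjugate.symm {S T : Set (LieSubalgebra F L)} (h : Conjugate S T) : Conjugate T S := by
  obtain ⟨φ, hφ⟩ := h
  have hid : ∀ H : LieSubalgebra F L, (H.map φ.toLieHom).map φ.symm.toLieHom = H := fun H => by
    ext x
    simp only [LieSubalgebra.mem_map]
    constructor
    · rintro ⟨_, ⟨y, hy, rfl⟩, rfl⟩
      exact (φ.symm_apply_apply y).symm ▸ hy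
    · exact fun hx => ⟨_, ⟨x, hx, rfl⟩, φ.symm_apply_apply x⟩
  refine ⟨φ.symm, ?_⟩
  refine ⟨?_, (map_injective_of_equiv φ.symm).injOn, ?_⟩
  · intro K hK
    obtain ⟨H, hH, rfl⟩ := hφ.surjOn hK
    change (H.map φ.toLieHom).map φ.symm.toLieHom ∈ S
    rwa [hid]
  · intro H hH
    exact ⟨_, hφ.mapsTo hH, hid H⟩

end Conjugacy

/-! ### Reduction to the standard decomposition -/

theorem cart_one_ne_top : (cart (1 : GL (Fin 3) F)).toSubmodule ≠ ⊤ := fun h => by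
  have hm : cyc (1 : F) 1 1 ∈ (cart (1 : GL (Fin 3) F)).toSubmodule := h ▸ Submodule.mem_top
  have := mem_cart_one.1 hm (show (0 : Fin 3) ≠ 1 by decide)
  simp [coe_cyc] at this

/-- A diagonal change of basis turns `cyc x y z` into `cyc 1 1 1`. -/
theorem exists_diagonal_normalizing {x y z : F} (hxyz : x * y * z = 1) :
    ∃ t : GL (Fin 3) F, t.val.IsDiag ∧ t⁻¹.val.IsDiag ∧ conj t (cyc x y z) = cyc 1 1 1 := by
  have h0 : x * y * z ≠ 0 := hxyz ▸ one_ne_zero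
  have hx := left_ne_zero_of_mul (left_ne_zero_of_mul h0)
  have hy := right_ne_zero_of_mul (left_ne_zero_of_mul h0)
  have hz := right_ne_zero_of_mul h0
  -- The entries of `t` make the first two nonzero entries equal to `1`; the third becomes `xyz =
  -- 1`.
  refine ⟨⟨diagonal ![1, x, x * y], diagonal ![1, x⁻¹, (x * y)⁻¹], ?_, ?_⟩, isDiag_diagonal _,
    isDiag_diagonal _, Subtype.ext ?_⟩
  · rw [diagonal_mul_diagonal, ← diagonal_one]
    congr 1
    funext i
    fin_cases i <;> simp <;> field_simp
  · rw [diagonal_mul_diagonal, ← diagonal_one]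
    congr 1
    funext i
    fin_cases i <;> simp <;> field_simp
  · change diagonal ![1, x, x * y] * (cyc x y z).val * diagonal ![1, x⁻¹, (x * y)⁻¹] = _
    rw [coe_cyc, coe_cyc]
    ext i j
    rw [mul_diagonal, diagonal_mul]
    fin_cases i <;> fin_cases j <;> simp <;> field_simp
    exact hxyz

/-- One conjugation makes a component diagonal. A second one, by a diagonal matrix, preserves that
component and brings another to the one containing `cyc 1 1 1`; `eq_range` then fixes the rest. -/
theorem IsOrthoCart.conjugate_range (h3 : (3 : F) ≠ 0) {ω : F} {f : Fin 4 → GL (Fin 3) F}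
    (h : IsStandard ω f) {S : Set (LieSubalgebra F (Sl3 F))} (hS : IsOrthoCart S) :
    Conjugate S (Set.range fun i => cart (f i)) := by
  obtain ⟨H, hH, -⟩ := hS.exists_ne _ cart_one_ne_top
  obtain ⟨g, rfl⟩ := hS.exists_eq_cart H hH
  refine (conjugate_image (conj g⁻¹) S).trans ?_
  have hS' := hS.image_conj g⁻¹
  have hone : cart 1 ∈ (fun H : LieSubalgebra F (Sl3 F) => H.map (conj g⁻¹).toLieHom) '' S :=
    ⟨cart g, hH, by simp only [map_conj_cart, inv_mul_cancel]⟩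
  generalize (fun H : LieSubalgebra F (Sl3 F) => H.map (conj g⁻¹).toLieHom) '' S = S' at hS' hone ⊢
  obtain ⟨K, hK, hne⟩ := hS'.exists_ne _ cart_one_ne_top
  obtain ⟨k, rfl⟩ := hS'.exists_eq_cart K hK
  obtain ⟨x, y, z, hxyz, hm⟩ := exists_cyc_mem h3 (hS'.ortho _ hK _ hone hne)
  obtain ⟨t, ht, ht', hconj⟩ := exists_diagonal_normalizing hxyz
  have hrange := h.eq_range h3 (hS'.image_conj t)
    ⟨_, hone, by
      change (cart 1).map (conj t).toLieHom = _
      rw [map_conj_cart, h.zero, mul_one, ← one_mul t, cart_mul_isDiag 1 t ht ht']⟩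
    ⟨_, hK, by
      change (cart k).map (conj t).toLieHom = _
      rw [map_conj_cart]
      refine cart_eq_of_cyc_mem h3 (x := 1) (y := 1) (z := 1) (by ring) ?_ h.one
      rw [← map_conj_cart, ← hconj]
      exact (LieSubalgebra.mem_map _ _ _).2 ⟨_, hm, rfl⟩⟩
  rw [← hrange]
  exact conjugate_image (conj t) S'

theorem natCast_ne_zero_of_lt_ringChar {n : ℕ} (hn : n ≠ 0) (h : n < ringChar F) :
    (n : F) ≠ 0 := fun h0 =>
  absurd (Nat.le_of_dvd (Nat.pos_of_ne_zero hn) ((ringChar.spec F n).1 h0)) (not_le.2 h)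

end COD

theorem theorem3p6 (F : Type*) [Field F] [IsAlgClosed F] (hF : 3 < ringChar F) :
    (∃ S : Set (LieSubalgebra F (LieAlgebra.SpecialLinear.sl (Fin 3) F)),
      COD.IsCOD S ∧ S.ncard = 4) ∧
    ∀ S T : Set (LieSubalgebra F (LieAlgebra.SpecialLinear.sl (Fin 3) F)),
      COD.IsCOD S → COD.IsCOD T → COD.Conjugate S T := by
  have h2 : (2 : F) ≠ 0 := by
    exact_mod_cast COD.natCast_ne_zero_of_lt_ringChar (F := F) two_ne_zero (by omega)
  have h3 : (3 : F) ≠ 0 := by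
    exact_mod_cast COD.natCast_ne_zero_of_lt_ringChar (F := F) three_ne_zero hF
  obtain ⟨ω, f, h⟩ := COD.exists_isStandard h3
  refine ⟨⟨_, h.isCOD hF h2 h3, h.ncard_range h3⟩, fun S T hS hT => ?_⟩
  exact ((hS.isOrthoCart h2 h3).conjugate_range h3 h).trans
    ((hT.isOrthoCart h2 h3).conjugate_range h3 h).symm
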